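/- For a real number $a$ and an integer $k\ge 0$ let $(a)_k=a(a+1)\cdots(a+k-1)$, $(a)_0=1$. For real $\alpha,\beta>-1$ and integers $0\le n\le N$ let $$Q_n(x,\alpha,\beta,N)=\sum_{k=0}^{n}\frac{(-n)_k\,(n+\alpha+\beta+1)_k\,(-x)_k}{k!\,(\alpha+1)_k\,(-N)_k}$$ be the Hahn polynomial of degree $n$. **Theorem 3.4.** Let $\alpha,\beta>-1$ be real numbers with $\alpha+\beta\le -1$, let $N\ge 1$ be an integer and let $n\in\{0,\dots,N-1\}$. Then for all real $x\in[0,N]$ $$|Q_n(x,\alpha,\beta,N)|\le \max\left\{1,\frac{(\beta+1)_n}{(\alpha+1)_n}\right\}\cdot\frac{(\alpha+\beta+2+N)_{n-1}}{(\alpha+\beta+2)_{n-1}}\cdot\frac{(n-1)!}{(N-n+1)_{n-1}},$$ where for $n=0$ the last two factors are read as $1$ (so the right-hand side is $1$). Moreover, the bound cannot be improved in general (Remark 3.5): for $N=4$, $n=2$, $\alpha=\beta=-\tfrac12$ the right-hand side equals $\tfrac53$, and $|Q_2(2,-\tfrac12,-\tfrac12,4)|=\tfrac53$, so equality holds at $x=2$.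 -/

import Mathlib

/-- The rising factorial `(a)_k = a (a + 1) ⋯ (a + k - 1)`, with `(a)_0 = 1`. -/
noncomputable def risingFactorial (a : ℝ) (k : ℕ) : ℝ := (ascPochhammer ℝ k).eval a

/-- The Hahn polynomial `Q_n(x, α, β, N)`, for `n ≤ N` and `α, β > -1`, as the terminating
hypergeometric series `₃F₂(-n, n + α + β + 1, -x; α + 1, -N; 1)`, evaluated at a real `x`. -/
noncomputable def hahnQ (n : ℕ) (x α β : ℝ) (N : ℕ) : ℝ :=
  ∑ k ∈ Finset.range (n + 1),
    (risingFactorial (-(n : ℝ)) k * risingFactorial ((n : ℝ) + α + β + 1) k *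
        risingFactorial (-x) k) /
      ((Nat.factorial k : ℝ) * risingFactorial (α + 1) k * risingFactorial (-(N : ℝ)) k)

/-- The right-hand side
`max {1, (β+1)_n / (α+1)_n} * ((α+β+2+N)_{n-1} / (α+β+2)_{n-1}) * ((n-1)! / (N-n+1)_{n-1})`.
For `n = 0` the index `n - 1` is truncated to `0`, so the value is then `1`. -/
noncomputable def hahnBound (n : ℕ) (α β : ℝ) (N : ℕ) : ℝ :=
  max 1 (risingFactorial (β + 1) n / risingFactorial (α + 1) n) *
    (risingFactorial (α + β + 2 + (N : ℝ)) (n - 1) / risingFactorial (α + β + 2) (n - 1)) *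
    ((Nat.factorial (n - 1) : ℝ) / risingFactorial ((N : ℝ) - (n : ℝ) + 1) (n - 1))

open Finset

/-! Put z = x/N, A_k = Q_k(x, α, β, N), B_k = Q_k(x, α, β+1, N-1), and q(A, B) = A² - 2(1-z)AB +
(1-z)B², which is nonnegative for 0 ≤ z ≤ 1. Completing the square in either variable, q = (A -
(1-z)B)² + z(1-z)B² = (1-z)(B - A)² + zA². Along (A_0, B_0), (A_1, B_0), (A_1, B_1), ... one
coordinate changes at a time. `hahnQ_contiguous_odd` says that A_k → A_{k+1} multiplies A - (1-z)B_k
by -(β+k+1)/(α+k+1); `hahnQ_contiguous_even` says that B_k → B_{k+1} multiplies B - A_{k+1} by -ρ.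
So each step multiplies q by at most the square of max(1, |factor|), and ρ ≥ 1 because α+β ≤ -1.
Since q(1, 1) = z and q ≥ zA², the factor z cancels when x > 0, leaving the product of the step
factors as the bound for |A_n|. -/

/-! ### Rising factorials and the series for Q_n. -/

theorem risingFactorial_zero (a : ℝ) : risingFactorial a 0 = 1 := by
  simp [risingFactorial]

theorem risingFactorial_succ (a : ℝ) (k : ℕ) :
    risingFactorial a (k + 1) = risingFactorial a k * (a + k) := by
  simp [risingFactorial, ascPochhammer_succ_eval]

theorem risingFactorial_succ_left (a : ℝ) (k : ℕ) :
    risingFactorial a (k + 1) = a * risingFactorial (a + 1) k := by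
  simp [risingFactorial, ascPochhammer_succ_left]

theorem mul_risingFactorial_add_one (a : ℝ) (k : ℕ) :
    a * risingFactorial (a + 1) k = risingFactorial a k * (a + k) := by
  rw [← risingFactorial_succ_left, risingFactorial_succ]

theorem risingFactorial_pos {a : ℝ} (ha : 0 < a) (k : ℕ) : 0 < risingFactorial a k :=
  ascPochhammer_pos k a ha

theorem risingFactorial_neg_ne_zero {N j : ℕ} (h : j ≤ N) :
    risingFactorial (-(N : ℝ)) j ≠ 0 := by
  induction j with
  | zero => simp [risingFactorial_zero]
  | succ j ih =>
    rw [risingFactorial_succ]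
    refine mul_ne_zero (ih (by omega)) ?_
    have : (j : ℝ) < N := by exact_mod_cast h
    linarith

theorem risingFactorial_neg_eq_zero {n j : ℕ} (h : n < j) :
    risingFactorial (-(n : ℝ)) j = 0 := by
  induction j with
  | zero => omega
  | succ j ih =>
    rw [risingFactorial_succ]
    rcases Nat.lt_succ_iff_lt_or_eq.mp h with h | rfl
    · rw [ih h, zero_mul]
    · simp

/-- The coefficient of `(-x)_j / (-N)_j` in the Hahn polynomial of degree `n`, where
`s = α + β + 1`. -/
noncomputable def hahnCoeff (n : ℕ) (α s : ℝ) (j : ℕ) : ℝ :=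
  risingFactorial (-(n : ℝ)) j * risingFactorial ((n : ℝ) + s) j /
    ((j.factorial : ℝ) * risingFactorial (α + 1) j)

theorem hahnCoeff_eq_zero {n j : ℕ} (h : n < j) (α s : ℝ) : hahnCoeff n α s j = 0 := by
  simp [hahnCoeff, risingFactorial_neg_eq_zero h]

/-- Padding with zero terms lets polynomials of different degrees be compared term by term. -/
theorem hahnQ_eq_sum {n M : ℕ} (h : n < M) (x α β : ℝ) (N : ℕ) :
    hahnQ n x α β N = ∑ j ∈ range M,
      hahnCoeff n α (α + β + 1) j * (risingFactorial (-x) j / risingFactorial (-(N : ℝ)) j) := by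
  have hsub : range (n + 1) ⊆ range M := range_subset_range.mpr h
  rw [hahnQ, ← sum_subset hsub]
  · refine sum_congr rfl fun j _ => ?_
    rw [hahnCoeff, div_mul_div_comm]
    simp only [← add_assoc]
  · intro j _ hj
    rw [hahnCoeff_eq_zero (by simpa using hj), zero_mul]

theorem hahnQ_degree_zero (x α β : ℝ) (N : ℕ) : hahnQ 0 x α β N = 1 := by
  simp [hahnQ, risingFactorial_zero]

theorem hahnQ_at_zero (n : ℕ) (α β : ℝ) (N : ℕ) : hahnQ n 0 α β N = 1 := by
  rw [hahnQ, sum_range_succ']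
  have h (j : ℕ) : risingFactorial (0 : ℝ) (j + 1) = 0 := by
    simpa using risingFactorial_neg_eq_zero (Nat.succ_pos j)
  simp [h, risingFactorial_zero]

/-! ### Contiguous relations between the parameters (β, N) and (β+1, N-1). -/

theorem hahnCoeff_contiguous_even (k : ℕ) {α s : ℝ} (hs : -1 < s) (N : ℝ) (j : ℕ) :
    (N - (k + 1)) * (k + 1 + s) * hahnCoeff (k + 1) α (s + 1) j
        + (k + 1) * (N + (k + 1) + s) * hahnCoeff k α (s + 1) j =
      (2 * (k + 1) + s) * (N - j) * hahnCoeff (k + 1) α s j := by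
  have hk : (0 : ℝ) ≤ k := k.cast_nonneg
  have e1 := mul_risingFactorial_add_one ((k : ℝ) + 1 + s) j
  have e2 := mul_risingFactorial_add_one (-((k : ℝ) + 1)) j
  have h1 : (k : ℝ) + 1 + s ≠ 0 := by linarith
  have h2 : -((k : ℝ) + 1) ≠ 0 := by linarith
  have h2' : (k : ℝ) + 1 ≠ 0 := by linarith
  have e1' : risingFactorial ((k : ℝ) + 1 + s + 1) j =
      risingFactorial ((k : ℝ) + 1 + s) j * ((k : ℝ) + 1 + s + j) / ((k : ℝ) + 1 + s) := by
    rw [eq_div_iff h1, ← e1, mul_comm]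
  have e2' : risingFactorial (-((k : ℝ) + 1) + 1) j =
      risingFactorial (-((k : ℝ) + 1)) j * (-((k : ℝ) + 1) + j) / (-((k : ℝ) + 1)) := by
    rw [eq_div_iff h2, ← e2, mul_comm]
  have a1 : (k : ℝ) + 1 + (s + 1) = k + 1 + s + 1 := by ring
  have a2 : (k : ℝ) + (s + 1) = k + 1 + s := by ring
  have a3 : -(k : ℝ) = -((k : ℝ) + 1) + 1 := by ring
  simp only [hahnCoeff, Nat.cast_add, Nat.cast_one]
  rw [a1, a2, a3, e1', e2']
  field_simp
  ring

theorem hahnQ_contiguous_even (k M : ℕ) (hk : k < M) {α β : ℝ} (hs : -1 < α + β + 1) (x : ℝ) :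
    ((M : ℝ) + 1 - (k + 1)) * (k + 1 + (α + β + 1)) *
        (hahnQ (k + 1) x α (β + 1) M - hahnQ (k + 1) x α β (M + 1)) =
      (k + 1) * ((M : ℝ) + 1 + (k + 1) + (α + β + 1)) *
        (hahnQ (k + 1) x α β (M + 1) - hahnQ k x α (β + 1) M) := by
  set s := α + β + 1 with hsdef
  suffices h : ((M : ℝ) + 1 - (k + 1)) * (k + 1 + s) * hahnQ (k + 1) x α (β + 1) M
      + (k + 1) * ((M : ℝ) + 1 + (k + 1) + s) * hahnQ k x α (β + 1) M =
      (2 * (k + 1) + s) * (M + 1) * hahnQ (k + 1) x α β (M + 1) by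
    linear_combination h
  have es : α + (β + 1) + 1 = s + 1 := by rw [hsdef]; ring
  rw [hahnQ_eq_sum (show k + 1 < k + 2 by omega), hahnQ_eq_sum (show k < k + 2 by omega),
    hahnQ_eq_sum (show k + 1 < k + 2 by omega), mul_sum, mul_sum, mul_sum, ← sum_add_distrib, es,
    ← hsdef]
  refine sum_congr rfl fun j hj => ?_
  have hj' : j ≤ M := by simp at hj; omega
  have hjM : (j : ℝ) ≤ M := by exact_mod_cast hj'
  have d1 := risingFactorial_neg_ne_zero hj'
  have e := mul_risingFactorial_add_one (-((M + 1 : ℕ) : ℝ)) j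
  have a : -((M + 1 : ℕ) : ℝ) + 1 = -(M : ℝ) := by push_cast; ring
  rw [a] at e
  have hc := hahnCoeff_contiguous_even k (α := α) hs ((M : ℝ) + 1) j
  have hN : (M : ℝ) + 1 ≠ 0 := by positivity
  push_cast at e ⊢
  have hNj : (M : ℝ) + 1 - j ≠ 0 := by linarith
  -- Both denominators are expressed through (-M)_j; this produces the factor N - j of the
  -- coefficient identity.
  have e' : risingFactorial (-((M : ℝ) + 1)) j =
      ((M : ℝ) + 1) * risingFactorial (-(M : ℝ)) j / ((M : ℝ) + 1 - j) := by
    rw [eq_div_iff hNj]; linear_combination e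
  rw [e']
  field_simp
  linear_combination risingFactorial (-x) j * hc

theorem hahnCoeff_zero (k : ℕ) (α s : ℝ) :
    hahnCoeff k α s 0 = 1 := by
  simp [hahnCoeff, risingFactorial_zero]

theorem hahnCoeff_contiguous_odd (k : ℕ) {α : ℝ} (hα : -1 < α) (s : ℝ) (j : ℕ) :
    (2 * k + 1 + s) * (hahnCoeff k α (s + 1) (j + 1) - hahnCoeff k α (s + 1) j) =
      (α + k + 1) * hahnCoeff (k + 1) α s (j + 1)
        + (s - α + k) * hahnCoeff k α s (j + 1) := by
  have hk : (0 : ℝ) ≤ k := k.cast_nonneg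
  have r0 : risingFactorial (α + 1) j ≠ 0 := (risingFactorial_pos (by linarith) j).ne'
  have hαj : α + 1 + j ≠ 0 := by
    have : (0 : ℝ) ≤ j := j.cast_nonneg
    linarith
  have a1 : (k : ℝ) + (s + 1) = k + s + 1 := by ring
  have a2 : (k : ℝ) + 1 + s = k + s + 1 := by ring
  have e1 : risingFactorial ((k : ℝ) + s) (j + 1) =
      (k + s) * risingFactorial ((k : ℝ) + s + 1) j := risingFactorial_succ_left _ _
  have e2 : risingFactorial (-((k : ℝ) + 1)) (j + 1) =
      -(k + 1) * risingFactorial (-(k : ℝ)) j := by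
    rw [risingFactorial_succ_left]; congr 2; ring
  simp only [hahnCoeff, Nat.cast_add, Nat.cast_one, Nat.factorial_succ, Nat.cast_mul]
  rw [a1, a2, e1, e2, risingFactorial_succ _ j, risingFactorial_succ _ j, risingFactorial_succ _ j]
  field_simp
  ring

theorem hahnQ_contiguous_odd (k M : ℕ) (hk : k < M) {α : ℝ} (hα : -1 < α)
    (β x : ℝ) :
    (α + k + 1) * (hahnQ (k + 1) x α β (M + 1) -
        (1 - x / (M + 1)) * hahnQ k x α (β + 1) M) =
      (β + k + 1) * ((1 - x / (M + 1)) * hahnQ k x α (β + 1) M - hahnQ k x α β (M + 1)) := by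
  set s := α + β + 1 with hsdef
  suffices h : (2 * k + 1 + s) * ((1 - x / (M + 1)) * hahnQ k x α (β + 1) M) =
      (α + k + 1) * hahnQ (k + 1) x α β (M + 1) + (s - α + k) * hahnQ k x α β (M + 1) by
    rw [hsdef] at h
    linear_combination -h
  have es : α + (β + 1) + 1 = s + 1 := by rw [hsdef]; ring
  set ψ : ℕ → ℝ := fun j => risingFactorial (-x) j / risingFactorial (-((M + 1 : ℕ) : ℝ)) j
    with hψ
  have hN : (M : ℝ) + 1 ≠ 0 := by positivity
  -- The factor 1 - x/N turns the basis for N-1 into differences of the basis ψ for N, so summation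
  -- by parts applies.
  have hshift : ∀ j ∈ range (k + 1), (1 - x / (M + 1)) *
      (risingFactorial (-x) j / risingFactorial (-(M : ℝ)) j) = ψ j - ψ (j + 1) := by
    intro j hj
    have hj' : j ≤ M := by simp at hj; omega
    have hjM : (j : ℝ) ≤ M := by exact_mod_cast hj'
    have d1 := risingFactorial_neg_ne_zero hj'
    have e := mul_risingFactorial_add_one (-((M + 1 : ℕ) : ℝ)) j
    have a : -((M + 1 : ℕ) : ℝ) + 1 = -(M : ℝ) := by push_cast; ring
    rw [a] at e
    simp only [hψ]
    rw [risingFactorial_succ, risingFactorial_succ]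
    push_cast at e ⊢
    have hNj : (M : ℝ) + 1 - j ≠ 0 := by linarith
    have hNj' : -((M : ℝ) + 1) + j ≠ 0 := by intro h; apply hNj; linarith
    have e' : risingFactorial (-((M : ℝ) + 1)) j =
        -((M : ℝ) + 1) * risingFactorial (-(M : ℝ)) j / (-((M : ℝ) + 1) + j) := by
      rw [eq_div_iff hNj']; linear_combination -e
    rw [e']
    field_simp
    ring
  rw [hahnQ_eq_sum (show k < k + 1 by omega), hahnQ_eq_sum (show k + 1 < k + 2 by omega),
    hahnQ_eq_sum (show k < k + 2 by omega), es, ← hsdef]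
  have hL : (1 - x / (M + 1)) * ∑ j ∈ range (k + 1), hahnCoeff k α (s + 1) j *
      (risingFactorial (-x) j / risingFactorial (-(M : ℝ)) j) =
      ∑ j ∈ range (k + 1), hahnCoeff k α (s + 1) j * ψ j -
        ∑ j ∈ range (k + 1), hahnCoeff k α (s + 1) j * ψ (j + 1) := by
    rw [mul_sum, ← sum_sub_distrib]
    refine sum_congr rfl fun j hj => ?_
    rw [← mul_sub, ← hshift j hj]
    ring
  have hL' : ∑ j ∈ range (k + 1), hahnCoeff k α (s + 1) j * ψ j =
      ∑ j ∈ range (k + 1), hahnCoeff k α (s + 1) (j + 1) * ψ (j + 1) + ψ 0 := by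
    -- The index shift is free: the added top coefficient, of index k+1 in degree k, is zero.
    rw [← add_zero (∑ j ∈ range (k + 1), hahnCoeff k α (s + 1) j * ψ j),
      ← zero_mul (ψ (k + 1)), ← hahnCoeff_eq_zero (Nat.lt_succ_self k) α (s + 1),
      ← sum_range_succ (fun j => hahnCoeff k α (s + 1) j * ψ j), sum_range_succ',
      hahnCoeff_zero, one_mul]
  change _ = (α + k + 1) * ∑ j ∈ range (k + 1 + 1), hahnCoeff (k + 1) α s j * ψ j +
    (s - α + k) * ∑ j ∈ range (k + 1 + 1), hahnCoeff k α s j * ψ j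
  rw [hL, hL', sum_range_succ' (fun j => hahnCoeff (k + 1) α s j * ψ j),
    sum_range_succ' (fun j => hahnCoeff k α s j * ψ j), hahnCoeff_zero, hahnCoeff_zero]
  have hsum := sum_congr rfl fun j (_ : j ∈ range (k + 1)) =>
    congrArg (· * ψ (j + 1)) (hahnCoeff_contiguous_odd k hα s j)
  simp only [mul_assoc, add_mul, sub_mul, mul_sub, sum_add_distrib, sum_sub_distrib,
    ← mul_sum] at hsum ⊢
  linear_combination hsum

/-! ### Growth factors and their products. -/

/-- The product `∏_{k=1}^{m} k (N + k + α + β + 1) / ((N - k) (k + α + β + 1))`. -/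
noncomputable def hahnDriftProd (m : ℕ) (α β : ℝ) (N : ℕ) : ℝ :=
  (risingFactorial (α + β + 2 + (N : ℝ)) m / risingFactorial (α + β + 2) m) *
    ((Nat.factorial m : ℝ) / risingFactorial ((N : ℝ) - m) m)

theorem hahnDriftProd_zero (α β : ℝ) (N : ℕ) : hahnDriftProd 0 α β N = 1 := by
  simp [hahnDriftProd, risingFactorial_zero]

theorem hahnDriftProd_succ {m N : ℕ} (h : m + 1 < N) {α β : ℝ} (hαβ : -2 < α + β) :
    hahnDriftProd (m + 1) α β N =
      (m + 1) * (N + (m + 1) + (α + β + 1)) / ((N - (m + 1)) * (m + 1 + (α + β + 1))) *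
        hahnDriftProd m α β N := by
  have hN : (m : ℝ) + 1 < N := by exact_mod_cast h
  have hm : (0 : ℝ) ≤ m := m.cast_nonneg
  have h1 : (N : ℝ) - (m + 1) ≠ 0 := by linarith
  have h2 : (m : ℝ) + 1 + (α + β + 1) ≠ 0 := by linarith
  have h2' : α + β + 2 + (m : ℝ) ≠ 0 := by linarith
  have h3 : risingFactorial ((N : ℝ) - m) m ≠ 0 := (risingFactorial_pos (by linarith) m).ne'
  have h4 : risingFactorial (α + β + 2) m ≠ 0 := (risingFactorial_pos (by linarith) m).ne'
  have a : (N : ℝ) - (m + 1) + 1 = N - m := by ring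
  simp only [hahnDriftProd, Nat.cast_add, Nat.cast_one, Nat.factorial_succ, Nat.cast_mul]
  rw [risingFactorial_succ_left ((N : ℝ) - (m + 1)), a, risingFactorial_succ,
    risingFactorial_succ]
  field_simp
  ring

theorem hahnDriftProd_nonneg {m N : ℕ} (h : m < N) {α β : ℝ} (hαβ : -2 < α + β) :
    0 ≤ hahnDriftProd m α β N := by
  have hN : (m : ℝ) < N := by exact_mod_cast h
  have h0 : (0 : ℝ) ≤ N := N.cast_nonneg
  have := risingFactorial_pos (show 0 < (N : ℝ) - m by linarith) m
  have := risingFactorial_pos (show 0 < α + β + 2 by linarith) m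
  have := risingFactorial_pos (show 0 < α + β + 2 + (N : ℝ) by linarith) m
  unfold hahnDriftProd
  positivity

/-- The ratios (b+k)/(a+k) all lie on the same side of 1, so max(1, ·) is multiplicative on them and
the stepwise maxima combine into a single one. -/
theorem max_one_risingFactorial_div_succ {a b : ℝ} (ha : 0 < a) (hb : 0 < b) (m : ℕ) :
    max 1 (risingFactorial b (m + 1) / risingFactorial a (m + 1)) =
      max 1 ((b + m) / (a + m)) * max 1 (risingFactorial b m / risingFactorial a m) := by
  have hm : (0 : ℝ) ≤ m := m.cast_nonneg
  have hsucc (k : ℕ) : risingFactorial b (k + 1) / risingFactorial a (k + 1) =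
      (b + k) / (a + k) * (risingFactorial b k / risingFactorial a k) := by
    rw [risingFactorial_succ, risingFactorial_succ, mul_div_mul_comm, mul_comm]
  rcases le_total a b with hab | hab
  · have hstep (k : ℕ) : 1 ≤ (b + k) / (a + k) := by
      rw [one_le_div (by positivity)]; linarith
    have hall (k : ℕ) : 1 ≤ risingFactorial b k / risingFactorial a k := by
      induction k with
      | zero => simp [risingFactorial_zero]
      | succ k ih => rw [hsucc]; exact one_le_mul_of_one_le_of_one_le (hstep k) ih
    rw [max_eq_right (hall _), max_eq_right (hall _), max_eq_right (hstep _), hsucc]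
  · have hstep (k : ℕ) : (b + k) / (a + k) ≤ 1 := by
      rw [div_le_one (by positivity)]; linarith
    have hall (k : ℕ) : risingFactorial b k / risingFactorial a k ≤ 1 := by
      induction k with
      | zero => simp [risingFactorial_zero]
      | succ k ih =>
        rw [hsucc]
        exact mul_le_one₀ (hstep k)
          (div_pos (risingFactorial_pos hb k) (risingFactorial_pos ha k)).le ih
    rw [max_eq_left (hall _), max_eq_left (hall _), max_eq_left (hstep _), one_mul]

/-! ### Growth of the quadratic form q. -/

theorem sq_energy_le {ρ c u v w : ℝ} (hc : 0 ≤ c) (hρ : 0 ≤ ρ) (huv : u = ρ * v) :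
    u ^ 2 + c * w ^ 2 ≤ (max 1 ρ) ^ 2 * (v ^ 2 + c * w ^ 2) := by
  have h1 : 1 ≤ (max 1 ρ) ^ 2 := one_le_pow₀ (le_max_left _ _)
  have h2 : ρ ^ 2 ≤ (max 1 ρ) ^ 2 := pow_le_pow_left₀ hρ (le_max_right _ _) 2
  have h3 := mul_le_mul_of_nonneg_right h2 (sq_nonneg v)
  have h4 := mul_le_mul_of_nonneg_right h1 (mul_nonneg hc (sq_nonneg w))
  rw [huv]
  nlinarith

section Energy

variable {M : ℕ} {α β x : ℝ}

theorem hahnQ_energy_odd_step (hα : -1 < α) (hβ : -1 < β) (hx : x ∈ Set.Icc (0 : ℝ) (M + 1))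
    {k : ℕ} (hk : k < M) :
    (hahnQ (k + 1) x α β (M + 1) - (1 - x / (M + 1)) * hahnQ k x α (β + 1) M) ^ 2 +
        (1 - x / (M + 1)) * (x / (M + 1)) * hahnQ k x α (β + 1) M ^ 2 ≤
      (max 1 ((β + 1 + k) / (α + 1 + k))) ^ 2 *
        ((1 - x / (M + 1)) * (hahnQ k x α (β + 1) M - hahnQ k x α β (M + 1)) ^ 2 +
          x / (M + 1) * hahnQ k x α β (M + 1) ^ 2) := by
  have hk0 : (0 : ℝ) ≤ k := k.cast_nonneg
  have hM : (0 : ℝ) < (M : ℝ) + 1 := by positivity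
  have hz0 : 0 ≤ x / ((M : ℝ) + 1) := div_nonneg hx.1 hM.le
  have hz1 : x / ((M : ℝ) + 1) ≤ 1 := (div_le_one hM).mpr hx.2
  have ha : 0 < α + 1 + k := by linarith
  have hb : 0 < β + 1 + k := by linarith
  have hrec := hahnQ_contiguous_odd k M hk hα β x
  have huv : hahnQ (k + 1) x α β (M + 1) - (1 - x / (M + 1)) * hahnQ k x α (β + 1) M =
      (β + 1 + k) / (α + 1 + k) *
        ((1 - x / (M + 1)) * hahnQ k x α (β + 1) M - hahnQ k x α β (M + 1)) := by
    rw [div_mul_eq_mul_div, eq_div_iff ha.ne']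
    linear_combination hrec
  -- The closing `ring` passes between the two completed-square forms of q(A_k, B_k).
  refine (sq_energy_le (mul_nonneg (sub_nonneg.mpr hz1) hz0) (div_pos hb ha).le huv).trans_eq ?_
  ring

theorem hahnQ_energy_even_step (hs : -1 < α + β + 1) (hs0 : α + β + 1 ≤ 0)
    (hx : x ∈ Set.Icc (0 : ℝ) (M + 1)) {k : ℕ} (hk : k < M) :
    (1 - x / (M + 1)) *
          (hahnQ (k + 1) x α (β + 1) M - hahnQ (k + 1) x α β (M + 1)) ^ 2 +
        x / (M + 1) * hahnQ (k + 1) x α β (M + 1) ^ 2 ≤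
      ((k + 1) * ((M : ℝ) + 1 + (k + 1) + (α + β + 1)) /
          (((M : ℝ) + 1 - (k + 1)) * (k + 1 + (α + β + 1)))) ^ 2 *
        ((hahnQ (k + 1) x α β (M + 1) - (1 - x / (M + 1)) * hahnQ k x α (β + 1) M) ^ 2 +
          (1 - x / (M + 1)) * (x / (M + 1)) * hahnQ k x α (β + 1) M ^ 2) := by
  have hk0 : (0 : ℝ) ≤ k := k.cast_nonneg
  have hkM : (k : ℝ) < M := by exact_mod_cast hk
  have hM : (0 : ℝ) < (M : ℝ) + 1 := by positivity
  have hz0 : 0 ≤ x / ((M : ℝ) + 1) := div_nonneg hx.1 hM.le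
  have hz1 : x / ((M : ℝ) + 1) ≤ 1 := (div_le_one hM).mpr hx.2
  have hrec := hahnQ_contiguous_even k M hk hs x
  have hd : 0 < ((M : ℝ) + 1 - (k + 1)) * (k + 1 + (α + β + 1)) :=
    mul_pos (by linarith) (by linarith)
  set ρ := (k + 1) * ((M : ℝ) + 1 + (k + 1) + (α + β + 1)) /
    (((M : ℝ) + 1 - (k + 1)) * (k + 1 + (α + β + 1))) with hρ
  -- Here α+β ≤ -1 enters: numerator minus denominator is 2(k+1)(k+1+s) - sN with -1 < s = α+β+1 ≤
  -- 0.
  have hρ1 : 1 ≤ ρ := by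
    rw [hρ, one_le_div hd]
    nlinarith
  have huv : hahnQ (k + 1) x α (β + 1) M - hahnQ (k + 1) x α β (M + 1) =
      ρ * (hahnQ (k + 1) x α β (M + 1) - hahnQ k x α (β + 1) M) := by
    rw [hρ, div_mul_eq_mul_div, eq_div_iff hd.ne']
    linear_combination hrec
  have hρ2 : 1 ≤ ρ ^ 2 := one_le_pow₀ hρ1
  have h := mul_le_mul_of_nonneg_right hρ2
    (mul_nonneg hz0 (sq_nonneg (hahnQ (k + 1) x α β (M + 1))))
  rw [huv]
  linear_combination h

theorem hahnQ_energy_le (hα : -1 < α) (hβ : -1 < β) (hαβ : α + β ≤ -1)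
    (hx : x ∈ Set.Icc (0 : ℝ) (M + 1)) {m : ℕ} (hm : m ≤ M) :
    (1 - x / (M + 1)) * (hahnQ m x α (β + 1) M - hahnQ m x α β (M + 1)) ^ 2 +
        x / (M + 1) * hahnQ m x α β (M + 1) ^ 2 ≤
      (max 1 (risingFactorial (β + 1) m / risingFactorial (α + 1) m) *
        hahnDriftProd m α β (M + 1)) ^ 2 * (x / (M + 1)) := by
  induction m with
  | zero => simp [hahnQ_degree_zero, hahnDriftProd_zero, risingFactorial_zero]
  | succ m ih =>
    refine (hahnQ_energy_even_step (by linarith) (by linarith) hx hm).trans ?_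
    refine (mul_le_mul_of_nonneg_left ((hahnQ_energy_odd_step hα hβ hx hm).trans
      (mul_le_mul_of_nonneg_left (ih (by omega)) (sq_nonneg _))) (sq_nonneg _)).trans_eq ?_
    rw [max_one_risingFactorial_div_succ (by linarith) (by linarith),
      hahnDriftProd_succ (by omega) (by linarith)]
    push_cast
    ring

theorem abs_hahnQ_succ_le (hα : -1 < α) (hβ : -1 < β) (hαβ : α + β ≤ -1)
    (hx : x ∈ Set.Icc (0 : ℝ) (M + 1)) (hx0 : 0 < x) {m : ℕ} (hm : m < M) :
    |hahnQ (m + 1) x α β (M + 1)| ≤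
      max 1 (risingFactorial (β + 1) (m + 1) / risingFactorial (α + 1) (m + 1)) *
        hahnDriftProd m α β (M + 1) := by
  have hM : (0 : ℝ) < (M : ℝ) + 1 := by positivity
  have hz0 : 0 < x / ((M : ℝ) + 1) := div_pos hx0 hM
  have hz1 : x / ((M : ℝ) + 1) ≤ 1 := (div_le_one hM).mpr hx.2
  have h := (hahnQ_energy_odd_step hα hβ hx hm).trans
    (mul_le_mul_of_nonneg_left (hahnQ_energy_le hα hβ hαβ hx hm.le) (sq_nonneg _))
  rw [max_one_risingFactorial_div_succ (by linarith) (by linarith)]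
  refine abs_le_of_sq_le_sq ?_ (mul_nonneg (by positivity)
    (hahnDriftProd_nonneg (by omega) (by linarith)))
  refine le_of_mul_le_mul_right ?_ hz0
  -- This is the term (1-z)(A - B)² dropped from q(A_{m+1}, B_m) to leave zA².
  have h1 := mul_nonneg (sub_nonneg.mpr hz1)
    (sq_nonneg (hahnQ (m + 1) x α β (M + 1) - hahnQ m x α (β + 1) M))
  linear_combination h + h1

end Energy

/-! ### The bound, including x = 0, and the case of equality. -/

/-- Needed at x = 0, where z cannot be cancelled but Q_n = 1. -/
theorem one_le_hahnDriftProd {m N : ℕ} (h : m < N) {α β : ℝ} (hs : -2 < α + β)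
    (hs0 : α + β ≤ -1) : 1 ≤ hahnDriftProd m α β N := by
  induction m with
  | zero => rw [hahnDriftProd_zero]
  | succ m ih =>
    have hN : (m : ℝ) + 1 < N := by exact_mod_cast h
    have hm : (0 : ℝ) ≤ m := m.cast_nonneg
    rw [hahnDriftProd_succ h hs]
    refine one_le_mul_of_one_le_of_one_le ?_ (ih (by omega))
    rw [one_le_div (mul_pos (by linarith) (by linarith))]
    nlinarith

theorem hahnBound_succ (m : ℕ) (α β : ℝ) (N : ℕ) :
    hahnBound (m + 1) α β N =
      max 1 (risingFactorial (β + 1) (m + 1) / risingFactorial (α + 1) (m + 1)) *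
        hahnDriftProd m α β N := by
  have a : (N : ℝ) - (m + 1) + 1 = N - m := by ring
  simp only [hahnBound, hahnDriftProd, Nat.add_sub_cancel, Nat.cast_add, Nat.cast_one, a,
    mul_assoc]

theorem abs_hahnQ_le_hahnBound {N n : ℕ} {α β x : ℝ} (hα : -1 < α) (hβ : -1 < β)
    (hαβ : α + β ≤ -1) (hn : n < N) (hx : x ∈ Set.Icc (0 : ℝ) N) :
    |hahnQ n x α β N| ≤ hahnBound n α β N := by
  cases n with
  | zero => simp [hahnQ_degree_zero, hahnBound, risingFactorial_zero]
  | succ m =>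
    obtain ⟨M, rfl⟩ : ∃ M, N = M + 1 := ⟨N - 1, by omega⟩
    rw [hahnBound_succ]
    rcases hx.1.eq_or_lt with rfl | hx0
    · rw [hahnQ_at_zero, abs_one]
      exact one_le_mul_of_one_le_of_one_le (le_max_left _ _)
        (one_le_hahnDriftProd (by omega) (by linarith) hαβ)
    · exact abs_hahnQ_succ_le hα hβ hαβ (by exact_mod_cast hx) hx0 (by omega)

theorem theorem3p4 :
    (∀ (N n : ℕ) (α β : ℝ), -1 < α → -1 < β → α + β ≤ -1 → n < N →
      ∀ x ∈ Set.Icc (0 : ℝ) (N : ℝ), |hahnQ n x α β N| ≤ hahnBound n α β N) ∧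
    (|hahnQ 2 2 (-1 / 2) (-1 / 2) 4| = 5 / 3 ∧ hahnBound 2 (-1 / 2) (-1 / 2) 4 = 5 / 3) := by

  refine ⟨fun N n α β hα hβ hαβ hn x hx => abs_hahnQ_le_hahnBound hα hβ hαβ hn hx, ?_, ?_⟩
  · simp only [hahnQ, sum_range_succ, risingFactorial_succ, risingFactorial_zero,
      range_zero, sum_empty, Nat.factorial]
    norm_num
  · simp only [hahnBound, risingFactorial_succ, risingFactorial_zero, Nat.add_one_sub_one,
      Nat.factorial]
    norm_num [risingFactorial_succ, risingFactorial_zero]
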